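/- Let $K$ be an algebraically closed field of characteristic zero, let $R=K[x_1,\dots,x_{n+1}]$ be the homogeneous coordinate ring of $\mathbb P^n$, and let $I\subseteq R$ be a homogeneous radical ideal. For $m\ge 0$ let $$I^{(m)}=R\cap\bigcap_{Q\in\operatorname{Ass}(R/I)}(I^m)_Q$$ be the $m$-th symbolic power of $I$. For a homogeneous ideal $J\subseteq R$ let $\mathrm{HF}_J(t)=\dim_K(R_t/J_t)$ be its Hilbert function, let $\mathrm{HP}_J$ be its Hilbert polynomial (the unique polynomial that agrees with $\mathrm{HF}_J(t)$ for all large integers $t$), and let $\operatorname{reg}(J)=\sup\{\,j-i:\operatorname{Tor}^R_i(J,K)_j\neq 0\,\}$ be its Castelnuovo--Mumford regularity. Assume that $I$ has linearly bounded symbolic regularity (LBSR), i.e. there are constants $a,b>0$ such that $\operatorname{reg}(I^{(m)})\le am+b$ for all sufficiently large $m$. Then for every $m\ge 1$ the function $t\mapsto \mathrm{HP}_{I^{(m)}}(mt)/m^n$ is a polynomial in $t$ of degree at most $n$; for every real $t$ (in particular for every integer $t$) the limit $$\mathrm{aHP}_I(t)=\lim_{m\to\infty}\frac{\mathrm{HP}_{I^{(m)}}(mt)}{m^n}$$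 exists; and the asymptotic Hilbert polynomial $\mathrm{aHP}_I$ is a polynomial function of $t$, with real coefficients, of degree at most $n$. -/

import Mathlib

open Filter Topology Polynomial

noncomputable section

namespace AsympHilbert

variable {K : Type*} [Field K] {n : ℕ}

/-- The homogeneous coordinate ring `K[x₁, …, xₙ₊₁]` of projective `n`-space. -/
abbrev CoordRing (K : Type*) [Field K] (n : ℕ) : Type _ := MvPolynomial (Fin (n + 1)) K

attribute [local instance] MvPolynomial.gradedAlgebra in
/-- `I` is a homogeneous ideal for the standard grading. -/
def IsHomogeneousIdeal (I : Ideal (CoordRing K n)) : Prop :=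
  I.IsHomogeneous (MvPolynomial.homogeneousSubmodule (Fin (n + 1)) K)

/-- The `m`-th symbolic power `I⁽ᵐ⁾ = R ∩ ⋂_{Q ∈ Ass(R/I)} (I ^ m)_Q`. -/
def symbolicPower (I : Ideal (CoordRing K n)) (m : ℕ) : Ideal (CoordRing K n) :=
  ⨅ Q : associatedPrimes (CoordRing K n) (CoordRing K n ⧸ I),
    haveI : Q.1.IsPrime := Q.2.isPrime
    ((I ^ m).map (algebraMap (CoordRing K n) (Localization.AtPrime Q.1))).comap
      (algebraMap (CoordRing K n) (Localization.AtPrime Q.1))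

/-- The Hilbert function `HF_J(t) = dim_K (R_t / J_t)`. -/
def hilbertFunction (J : Ideal (CoordRing K n)) (t : ℕ) : ℕ :=
  Module.finrank K (MvPolynomial.homogeneousSubmodule (Fin (n + 1)) K t ⧸
    (J.restrictScalars K).submoduleOf (MvPolynomial.homogeneousSubmodule (Fin (n + 1)) K t))

/-- `p` agrees with the Hilbert function of `J` in all large degrees. -/
def IsHilbertPolynomial (J : Ideal (CoordRing K n)) (p : ℚ[X]) : Prop :=
  ∀ᶠ t : ℕ in atTop, p.eval (t : ℚ) = (hilbertFunction J t : ℚ)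

theorem IsHilbertPolynomial.unique {J : Ideal (CoordRing K n)} {p q : ℚ[X]}
    (hp : IsHilbertPolynomial J p) (hq : IsHilbertPolynomial J q) : p = q := by
  obtain ⟨N, hN⟩ := eventually_atTop.1 (hp.and hq)
  refine Polynomial.eq_of_infinite_eval_eq p q ?_
  refine Set.Infinite.mono (s := (fun t : ℕ => (t : ℚ)) '' Set.Ici N) ?_ ?_
  · rintro _ ⟨t, ht, rfl⟩
    exact (hN t ht).1.trans (hN t ht).2.symm
  · exact (Set.Ici_infinite N).image Nat.cast_injective.injOn

open Classical in
/-- The Hilbert polynomial `HP_J`: the polynomial that agrees with `HF_J` in all large degrees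
(such a polynomial exists for every homogeneous ideal and is unique). -/
def hilbertPolynomial (J : Ideal (CoordRing K n)) : ℚ[X] :=
  if h : ∃ p : ℚ[X], IsHilbertPolynomial J p then h.choose else 0

theorem IsHilbertPolynomial.eq_hilbertPolynomial {J : Ideal (CoordRing K n)} {p : ℚ[X]}
    (hp : IsHilbertPolynomial J p) : hilbertPolynomial J = p := by
  have h : ∃ p : ℚ[X], IsHilbertPolynomial J p := ⟨p, hp⟩
  rw [hilbertPolynomial, dif_pos h]
  exact h.choose_spec.unique hp

/-! The Koszul complex of `x₁, …, xₙ₊₁` with coefficients in an ideal. A chain `ω` is given by its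
coefficients: it stands for `∑ ω S • e_S`, where `e_S` is the wedge product of the basis vectors
`e_s`, `s ∈ S`, up to reordering, and `e_S` has degree `#S`. -/

/-- The sign of `e_k` in `e_{T ∪ {k}}`. -/
def koszulSign (T : Finset (Fin (n + 1))) (k : Fin (n + 1)) : ℤˣ :=
  (-1) ^ (T.filter (· < k)).card

/-- The Koszul differential, `e_S ↦ ∑_{k ∈ S} ± x_k e_{S ∖ {k}}`. -/
def koszulD (K : Type*) [Field K] (n : ℕ) :
    (Finset (Fin (n + 1)) → CoordRing K n) →ₗ[K] (Finset (Fin (n + 1)) → CoordRing K n) where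
  toFun ω T := ∑ k ∈ Tᶜ, koszulSign T k • (MvPolynomial.X k * ω (insert k T))
  map_add' ω η := by
    funext T
    simp [mul_add, Finset.sum_add_distrib]
  map_smul' c ω := by
    funext T
    simp [Finset.smul_sum, smul_comm c]

theorem koszulSign_insert (T : Finset (Fin (n + 1))) (k l : Fin (n + 1)) (hk : k ∉ T) :
    koszulSign (insert k T) l = if k < l then -koszulSign T l else koszulSign T l := by
  unfold koszulSign
  rw [Finset.filter_insert]
  split_ifs with h
  · rw [Finset.card_insert_of_notMem (by simp [hk]), pow_succ]; simp
  · rfl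

theorem koszulD_koszulD (ω : Finset (Fin (n + 1)) → CoordRing K n) :
    koszulD K n (koszulD K n ω) = 0 := by
  funext T
  simp only [koszulD, LinearMap.coe_mk, AddHom.coe_mk, Pi.zero_apply, Finset.mul_sum,
    Finset.smul_sum]
  rw [Finset.sum_sigma']
  refine Finset.sum_involution (fun p _ => ⟨p.2, p.1⟩) ?_ ?_ ?_ ?_
  · rintro ⟨k, l⟩ h
    simp only [Finset.mem_sigma, Finset.mem_compl, Finset.mem_insert, not_or] at h
    obtain ⟨hk, hl⟩ := h
    simp only [koszulSign_insert _ _ _ hk, koszulSign_insert _ _ _ hl.2, Finset.insert_comm k l]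
    rcases lt_or_gt_of_ne hl.1 with h | h
    · simp only [h, not_lt.2 h.le, if_true, if_false, Units.smul_def, zsmul_eq_mul, Units.val_neg,
        Int.cast_neg]
      ring
    · simp only [h, not_lt.2 h.le, if_true, if_false, Units.smul_def, zsmul_eq_mul, Units.val_neg,
        Int.cast_neg]
      ring
  · rintro ⟨k, l⟩ h _ h'
    simp only [Finset.mem_sigma, Finset.mem_compl, Finset.mem_insert, not_or] at h
    exact h.2.1 (by simpa using (Sigma.mk.inj h').1)
  · rintro ⟨k, l⟩ h
    simp only [Finset.mem_sigma, Finset.mem_compl, Finset.mem_insert, not_or] at h ⊢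
    exact ⟨h.2.2, fun e => h.2.1 e.symm, h.1⟩
  · rintro ⟨k, l⟩ h
    rfl

/-- The chains `K_i(J)_j` of homological degree `i` and internal degree `j`: the coefficient of
`e_S` is zero unless `#S = i`, and it lies in `J` and is homogeneous of degree `j - i` (hence zero
if `j < i`). -/
def koszulChains (J : Ideal (CoordRing K n)) (i j : ℕ) :
    Submodule K (Finset (Fin (n + 1)) → CoordRing K n) :=
  Submodule.pi Set.univ fun S =>
    if S.card = i ∧ i ≤ j then
      J.restrictScalars K ⊓ MvPolynomial.homogeneousSubmodule (Fin (n + 1)) K (j - i)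
    else ⊥

/-- The cycles of bidegree `(i, j)`. -/
def koszulCycles (J : Ideal (CoordRing K n)) (i j : ℕ) :
    Submodule K (Finset (Fin (n + 1)) → CoordRing K n) :=
  koszulChains J i j ⊓ LinearMap.ker (koszulD K n)

/-- The boundaries of bidegree `(i, j)`. -/
def koszulBoundaries (J : Ideal (CoordRing K n)) (i j : ℕ) :
    Submodule K (Finset (Fin (n + 1)) → CoordRing K n) :=
  (koszulChains J (i + 1) j).map (koszulD K n)

theorem koszulBoundaries_le_koszulCycles (J : Ideal (CoordRing K n)) (i j : ℕ) :
    koszulBoundaries J i j ≤ koszulCycles J i j := by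
  rintro _ ⟨ω, hω, rfl⟩
  refine ⟨?_, koszulD_koszulD ω⟩
  intro S _
  have hω' := fun S => hω S trivial
  simp only at hω' ⊢
  change (∑ k ∈ Sᶜ, koszulSign S k • (MvPolynomial.X k * ω (insert k S))) ∈ _
  refine Submodule.sum_mem _ fun k hk => ?_
  rw [Units.smul_def]
  refine zsmul_mem ?_ _
  have hk' : k ∉ S := by simpa using hk
  have := hω' (insert k S)
  rw [Finset.card_insert_of_notMem hk'] at this
  by_cases hc : S.card + 1 = i + 1 ∧ i + 1 ≤ j
  · rw [if_pos hc] at this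
    rw [if_pos (by omega)]
    refine ⟨J.mul_mem_left _ this.1, ?_⟩
    have h2 := (MvPolynomial.isHomogeneous_X K k).mul this.2
    rwa [show 1 + (j - (i + 1)) = j - i by omega] at h2
  · rw [if_neg hc] at this
    rw [(Submodule.mem_bot K).1 this]; simp

/-- `Tor_i(J, K)_j`, computed as the Koszul homology of `J` in bidegree `(i, j)`. Its dimension is
the graded Betti number `β_{i,j}(J)`, the number of generators of degree `j` in step `i` of the
minimal graded free resolution of `J`. -/
abbrev koszulHomology (J : Ideal (CoordRing K n)) (i j : ℕ) : Type _ :=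
  koszulCycles J i j ⧸ (koszulBoundaries J i j).submoduleOf (koszulCycles J i j)

/-- The Castelnuovo–Mumford regularity `reg(J) = sup {j - i : Tor_i(J, K)_j ≠ 0}` of a homogeneous
ideal `J` (it is `-∞` for `J = 0`). -/
def regularity (J : Ideal (CoordRing K n)) : EReal :=
  ⨆ (i : ℕ) (j : ℕ) (_ : Nontrivial (koszulHomology J i j)), (((j : ℝ) - (i : ℝ) : ℝ) : EReal)

/-- Linearly bounded symbolic regularity (LBSR). -/
def IsLBSR (I : Ideal (CoordRing K n)) : Prop :=
  ∃ a b : ℝ, 0 < a ∧ 0 < b ∧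
    ∀ᶠ m : ℕ in atTop, regularity (symbolicPower I m) ≤ ((a * m + b : ℝ) : EReal)

/-- The polynomial `HP_{I⁽ᵐ⁾}(m t) / m ^ n` in the variable `t`. -/
def scaledHilbertPolynomial (I : Ideal (CoordRing K n)) (m : ℕ) : ℝ[X] :=
  C (((m : ℝ) ^ n)⁻¹) *
    ((hilbertPolynomial (symbolicPower I m)).map (algebraMap ℚ ℝ)).comp (C (m : ℝ) * X)

/-- The asymptotic Hilbert polynomial `aHP_I(t) = lim_m HP_{I⁽ᵐ⁾}(m t) / m ^ n`, as a function
of `t`. -/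
def aHP (I : Ideal (CoordRing K n)) (t : ℝ) : ℝ :=
  limUnder atTop fun m : ℕ =>
    ((hilbertPolynomial (symbolicPower I m)).map (algebraMap ℚ ℝ)).eval ((m : ℝ) * t) / (m : ℝ) ^ n

end AsympHilbert

end

/-! The linear bound on regularity turns the statement about Hilbert polynomials into one about
Hilbert functions, and those are handled by counting lattice points in a convex body, in the manner
of Newton–Okounkov bodies.

Reduction. The Hilbert series of `J` is a polynomial over `(1 - X) ^ (n + 1)`, and the coefficients
of its numerator in positive degrees are, up to sign, Euler characteristics of the graded strands of
the Koszul complex of `J`. Above the regularity plus `n + 1` the strands are exact, so the numerator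
stops and the Hilbert function equals the Hilbert polynomial
(`eval_hilbertPolynomial_of_regularity_le`). Under LBSR this covers degree `m * t` for every large
`m`, as soon as `t > a + b + n + 1`.

Counting. `dim J_t` is the number of leading exponents of degree `t`. Since `I⁽ᵃ⁾ I⁽ᵇ⁾ ⊆ I⁽ᵃ⁺ᵇ⁾`,
the leading exponents of the symbolic powers form a graded family of upper sets, whose rescalings by
`1 / m` fill an open convex set. Hence the count in degree `m * t`, divided by `m ^ n`, tends to the
volume of a slice of that set (`IsGradedFamily.tendsto_degreeCount`).

Conclusion. The rescaled Hilbert polynomials have degree at most `n` and converge at all large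
integers. By Lagrange interpolation at `n + 1` of these they converge everywhere, to a polynomial of
degree at most `n`.

Everything depends on the graded pieces `J_t` alone, so homogeneity of the ideals `I⁽ᵐ⁾` never has
to be established. -/

noncomputable section

namespace AsympHilbert

variable {K : Type*} [Field K] {n : ℕ}

/-! ### Generating functions of upper sets in `ℕ ^ k` -/

/-- The number of exponent vectors of total degree `t` in `A`. -/
def degreeCount {k : ℕ} (A : Set (Fin k → ℕ)) (t : ℕ) : ℕ :=
  {α ∈ A | ∑ i, α i = t}.ncard

theorem finite_setOf_sum_eq (k t : ℕ) : {α : Fin k → ℕ | ∑ i, α i = t}.Finite := by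
  refine (Set.finite_Iic (fun _ : Fin k => t)).subset fun α hα i => ?_
  rw [← (show ∑ i, α i = t from hα)]
  exact Finset.single_le_sum (fun _ _ => Nat.zero_le _) (Finset.mem_univ i)

theorem finite_degreeCount {k : ℕ} (A : Set (Fin k → ℕ)) (t : ℕ) :
    {α ∈ A | ∑ i, α i = t}.Finite :=
  (finite_setOf_sum_eq k t).subset fun _ h => h.2

/-- An increasing sequence of upper sets in `ℕ ^ k` is eventually constant. -/
theorem exists_forall_ge_eq_of_isUpperSet {k : ℕ} (B : ℕ → Set (Fin k → ℕ)) (hB : Monotone B)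
    (hu : ∀ i, IsUpperSet (B i)) : ∃ N, ∀ i, N ≤ i → B i = B N := by
  set U : Set (Fin k → ℕ) := ⋃ i, B i
  -- Dickson's lemma: the union has finitely many minimal elements, and an index by which all of
  -- them have appeared is where the sequence stabilises.
  have hfin : {x | Minimal (· ∈ U) x}.Finite :=
    WellQuasiOrderedLE.finite_of_isAntichain (setOfPred_minimal_antichain _)
  have hmem : ∀ x ∈ {x | Minimal (· ∈ U) x}, ∃ i, x ∈ B i := fun x hx => Set.mem_iUnion.1 hx.1
  choose! f hf using hmem
  obtain ⟨N, hN⟩ := (hfin.image f).bddAbove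
  have hU : U ⊆ B N := by
    intro x hx
    obtain ⟨y, hyx, hy⟩ := exists_minimal_le_of_wellFoundedLT (· ∈ U) x hx
    exact hu N hyx (hB (hN ⟨y, hy, rfl⟩) (hf y hy))
  exact ⟨N, fun i hi => ((Set.subset_iUnion B i).trans hU).antisymm (hB hi)⟩

theorem degreeCount_succ {k : ℕ} (A : Set (Fin (k + 1) → ℕ)) (t : ℕ) :
    degreeCount A t =
      ∑ i ∈ Finset.range (t + 1), degreeCount {β | (Fin.cons i β : Fin (k + 1) → ℕ) ∈ A} (t - i) := by
  classical
  have h : {α ∈ A | ∑ i, α i = t} = ⋃ i ∈ (Finset.range (t + 1) : Set ℕ),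
      (fun β : Fin k → ℕ => (Fin.cons i β : Fin (k + 1) → ℕ)) ''
        {β ∈ {β | (Fin.cons i β : Fin (k + 1) → ℕ) ∈ A} | ∑ l, β l = t - i} := by
    ext α
    simp only [Set.mem_iUnion, Finset.coe_range, Set.mem_Iio, Set.mem_image, Set.mem_ofPred_eq, exists_prop]
    constructor
    · rintro ⟨hA, hs⟩
      rw [Fin.sum_univ_succ] at hs
      refine ⟨α 0, by omega, Fin.tail α, ⟨by simpa using hA, ?_⟩, by simp⟩
      simp only [Fin.tail]
      omega
    · rintro ⟨i, hi, β, ⟨hA, hs⟩, rfl⟩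
      refine ⟨hA, ?_⟩
      rw [Fin.sum_cons, hs]
      omega
  rw [degreeCount, h, Set.Finite.ncard_biUnion (Finset.finite_toSet _)
    (fun i _ => (finite_degreeCount _ _).image _), finsum_mem_coe_finset]
  · exact Finset.sum_congr rfl fun i _ =>
      Set.ncard_image_of_injective _ fun β γ h => (Fin.cons_inj.1 h).2
  · intro i _ j _ hij
    rw [Function.onFun, Set.disjoint_left]
    rintro _ ⟨β, _, rfl⟩ ⟨γ, _, h⟩
    exact hij (Fin.cons_inj.1 h).1.symm

/-- The generating function of an upper set in `ℕ ^ k` is rational with denominator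
`(1 - X) ^ k`. -/
theorem exists_mk_degreeCount_mul_eq_coe (k : ℕ) (A : Set (Fin k → ℕ)) (hA : IsUpperSet A) :
    ∃ p : ℚ[X], PowerSeries.mk (fun t => (degreeCount A t : ℚ)) *
      (1 - PowerSeries.X : PowerSeries ℚ) ^ k = (p : PowerSeries ℚ) := by
  induction k with
  | zero =>
    refine ⟨C (degreeCount A 0 : ℚ), ?_⟩
    ext t
    rw [pow_zero, mul_one, PowerSeries.coeff_mk, Polynomial.coeff_coe, Polynomial.coeff_C]
    split_ifs with h
    · rw [h]
    · have : {α ∈ A | ∑ i, α i = t} = ∅ := by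
        ext α
        simp [Ne.symm h]
      rw [degreeCount, this, Set.ncard_empty, Nat.cast_zero]
  | succ k ih =>
    set B : ℕ → Set (Fin k → ℕ) := fun i => {β | (Fin.cons i β : Fin (k + 1) → ℕ) ∈ A} with hBdef
    have hu : ∀ i, IsUpperSet (B i) := fun i β γ h hβ =>
      hA (Fin.cons_le_cons.2 ⟨le_rfl, h⟩) hβ
    have hm : Monotone B := fun i j hij β hβ => hA (Fin.cons_le_cons.2 ⟨hij, le_rfl⟩) hβ
    obtain ⟨N, hN⟩ := exists_forall_ge_eq_of_isUpperSet B hm hu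
    choose p hp using fun i => ih (B i) (hu i)
    set F : ℕ → PowerSeries ℚ := fun i => PowerSeries.mk (fun t => (degreeCount (B i) t : ℚ))
    -- Slicing by the first coordinate gives the series `∑ X ^ i * F i`. Since `F i = F N` for `i ≥
    -- N`, subtracting `F N` from every term leaves a finite sum plus `F N / (1 - X)`.
    have key : PowerSeries.mk (fun t => (degreeCount A t : ℚ)) =
        ∑ i ∈ Finset.range N, PowerSeries.X ^ i * (F i - F N) + PowerSeries.mk 1 * F N := by
      ext t
      have h1 : (PowerSeries.coeff t) (PowerSeries.mk 1 * F N) =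
          ∑ i ∈ Finset.range (t + 1), (degreeCount (B N) (t - i) : ℚ) := by
        rw [PowerSeries.coeff_mul, Finset.Nat.sum_antidiagonal_eq_sum_range_succ_mk]
        simp [F]
      have h2 : (PowerSeries.coeff t) (∑ i ∈ Finset.range N, PowerSeries.X ^ i * (F i - F N)) =
          ∑ i ∈ Finset.range (t + 1),
            ((degreeCount (B i) (t - i) : ℚ) - degreeCount (B N) (t - i)) := by
        rw [map_sum]
        simp only [PowerSeries.coeff_X_pow_mul', map_sub, F, PowerSeries.coeff_mk]
        rw [← Finset.sum_filter]
        refine Finset.sum_subset (fun i => ?_) fun i hi hi' => ?_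
        · simp only [Finset.mem_filter, Finset.mem_range]
          omega
        · simp only [Finset.mem_filter, Finset.mem_range] at hi hi'
          rw [hN i (by omega), sub_self]
      rw [map_add, h1, h2, PowerSeries.coeff_mk, degreeCount_succ, Finset.sum_sub_distrib]
      push_cast
      ring
    refine ⟨∑ i ∈ Finset.range N, X ^ i * (p i - p N) * (1 - X) + p N, ?_⟩
    have hF : ∀ i, F i * (1 - PowerSeries.X : PowerSeries ℚ) ^ k = (p i : PowerSeries ℚ) := hp
    have h1 : (PowerSeries.mk 1 : PowerSeries ℚ) * (1 - PowerSeries.X) = 1 :=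
      PowerSeries.mk_one_mul_one_sub_eq_one ℚ
    rw [key, add_mul, Finset.sum_mul, Polynomial.coe_add, ← hF N]
    congr 1
    · rw [← Polynomial.coeToPowerSeries.ringHom_apply, map_sum]
      refine Finset.sum_congr rfl fun i _ => ?_
      simp only [map_mul, map_pow, map_sub, Polynomial.coeToPowerSeries.ringHom_apply,
        Polynomial.coe_X, ← hF, map_one]
      ring
    · rw [pow_succ, mul_comm (PowerSeries.mk 1), mul_assoc, ← mul_assoc (PowerSeries.mk 1),
        mul_comm (PowerSeries.mk 1), mul_assoc, h1, mul_one]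

/-! ### Leading exponents and dimensions of graded pieces -/

open MonomialOrder in
/-- The dimension of a space of polynomials is the number of its leading exponents. -/
theorem finrank_eq_ncard_degree {σ : Type*} (m : MonomialOrder σ)
    (W : Submodule K (MvPolynomial σ K)) [FiniteDimensional K W] :
    Module.finrank K W = {α | ∃ f ∈ W, f ≠ 0 ∧ m.degree f = α}.ncard := by
  classical
  set D : Set (σ →₀ ℕ) := {α | ∃ f ∈ W, f ≠ 0 ∧ m.degree f = α}
  choose f hfW hf0 hfd using fun α : D => α.2
  have hcoeff : ∀ α : D, (f α).coeff α ≠ 0 := fun α => by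
    rw [← hfd α]
    exact m.coeff_degree_ne_zero_iff.2 (hf0 α)
  have hli : LinearIndependent K f := by
    rw [linearIndependent_iff']
    intro s c hc
    by_contra! hne
    obtain ⟨i, his, hi⟩ := hne
    -- Only the term with the largest leading exponent among those with nonzero coefficient
    -- contributes to the coefficient of that exponent, so the relation fails there.
    obtain ⟨α, hα, hmax⟩ := Finset.exists_max_image (s.filter fun β => c β ≠ 0)
      (fun β => m.toSyn β) ⟨i, Finset.mem_filter.2 ⟨his, hi⟩⟩
    rw [Finset.mem_filter] at hα
    have h := congrArg (MvPolynomial.coeff (α : σ →₀ ℕ)) hc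
    rw [MvPolynomial.coeff_sum, Finset.sum_eq_single α, MvPolynomial.coeff_smul,
      MvPolynomial.coeff_zero, smul_eq_mul] at h
    · exact mul_ne_zero hα.2 (hcoeff α) h
    · intro β hβ hne
      rw [MvPolynomial.coeff_smul, smul_eq_mul]
      by_cases hcβ : c β = 0
      · rw [hcβ, zero_mul]
      · rw [m.coeff_eq_zero_of_lt, mul_zero]
        rw [hfd β]
        refine lt_of_le_of_ne (hmax β (Finset.mem_filter.2 ⟨hβ, hcβ⟩)) fun h => hne ?_
        exact Subtype.ext (m.toSyn.injective h)
    · exact fun h => absurd hα.1 h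
  have hspan : Submodule.span K (Set.range f) = W := by
    refine le_antisymm (Submodule.span_le.2 ?_) ?_
    · rintro _ ⟨α, rfl⟩
      exact hfW α
    -- Division by well-founded induction on the leading exponent: subtracting the multiple of `f α`
    -- with the same leading term lowers it.
    · suffices h : ∀ (a : m.syn) (g : MvPolynomial σ K), m.toSyn (m.degree g) = a → g ∈ W →
          g ∈ Submodule.span K (Set.range f) from fun g hg => h _ g rfl hg
      intro a
      induction a using WellFoundedLT.induction with
      | ind a ih =>
      rintro g rfl hg
      by_cases hg0 : g = 0
      · rw [hg0]
        exact zero_mem _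
      let α : D := ⟨m.degree g, g, hg, hg0, rfl⟩
      set r : K := g.coeff (m.degree g) / (f α).coeff (m.degree g)
      have hr : (g - r • f α).coeff (m.degree g) = 0 := by
        rw [MvPolynomial.coeff_sub, MvPolynomial.coeff_smul, smul_eq_mul,
          div_mul_cancel₀ _ (hcoeff α), sub_self]
      have hmem : r • f α ∈ Submodule.span K (Set.range f) :=
        Submodule.smul_mem _ _ (Submodule.subset_span ⟨α, rfl⟩)
      have hW : g - r • f α ∈ W := W.sub_mem hg (W.smul_mem _ (hfW α))
      have hgoal : g - r • f α ∈ Submodule.span K (Set.range f) := by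
        by_cases h0 : g - r • f α = 0
        · rw [h0]
          exact zero_mem _
        refine ih _ ?_ _ rfl hW
        refine lt_of_le_of_ne (m.degree_sub_le.trans (sup_le le_rfl ?_)) fun h => ?_
        · refine m.degree_smul_le.trans ?_
          rw [hfd α]
        · rw [← m.toSyn.injective h] at hr
          exact m.coeff_degree_ne_zero_iff.2 h0 hr
      simpa using add_mem hgoal hmem
  have hfin : Finite D := by
    have : LinearIndependent K (fun α => (⟨f α, hfW α⟩ : W)) := by
      refine LinearIndependent.of_comp W.subtype ?_
      exact hli
    exact this.finite
  have := Fintype.ofFinite D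
  rw [← hspan, finrank_span_eq_card hli, ← Nat.card_eq_fintype_card, Nat.card_coe_set_eq]

/-- The homogeneous component `J_t` of an ideal. -/
def gradedPiece (J : Ideal (CoordRing K n)) (t : ℕ) : Submodule K (CoordRing K n) :=
  J.restrictScalars K ⊓ MvPolynomial.homogeneousSubmodule (Fin (n + 1)) K t

instance (t : ℕ) :
    FiniteDimensional K (MvPolynomial.homogeneousSubmodule (Fin (n + 1)) K t) :=
  Module.Finite.iff_fg.2 (MvPolynomial.homogeneousSubmodule_fg (Fin (n + 1)) K t)

instance (J : Ideal (CoordRing K n)) (t : ℕ) : FiniteDimensional K (gradedPiece J t) :=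
  Submodule.finiteDimensional_of_le (inf_le_right : gradedPiece J t ≤ _)

/-- The leading exponents of the nonzero homogeneous elements of an ideal. -/
def leadExponents (J : Ideal (CoordRing K n)) : Set (Fin (n + 1) → ℕ) :=
  {α | ∃ f ∈ J, f ≠ 0 ∧ (∃ t, f.IsHomogeneous t) ∧ ⇑(MonomialOrder.lex.degree f) = α}

theorem sum_degree_of_isHomogeneous {f : CoordRing K n} {t : ℕ} (hf : f.IsHomogeneous t)
    (h0 : f ≠ 0) : ∑ i, MonomialOrder.lex.degree f i = t := by
  rw [← Finsupp.degree_eq_sum]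
  have := hf (MonomialOrder.lex.coeff_degree_ne_zero_iff.2 h0)
  rwa [Finsupp.degree_eq_weight_one]

theorem finrank_gradedPiece (J : Ideal (CoordRing K n)) (t : ℕ) :
    Module.finrank K (gradedPiece J t) = degreeCount (leadExponents J) t := by
  rw [finrank_eq_ncard_degree MonomialOrder.lex, degreeCount,
    ← Set.ncard_image_of_injective _ (DFunLike.coe_injective (F := Fin (n + 1) →₀ ℕ))]
  congr 1
  ext α
  constructor
  · rintro ⟨_, ⟨f, ⟨hJ, hf⟩, h0, rfl⟩, rfl⟩
    exact ⟨⟨f, hJ, h0, ⟨t, hf⟩, rfl⟩, sum_degree_of_isHomogeneous hf h0⟩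
  · rintro ⟨⟨f, hJ, h0, ⟨s, hf⟩, rfl⟩, hs⟩
    rw [sum_degree_of_isHomogeneous hf h0] at hs
    subst hs
    exact ⟨_, ⟨f, ⟨hJ, hf⟩, h0, rfl⟩, rfl⟩

/-- Leading exponents add under multiplication because the coefficients form a domain. With `J' = ⊤`
this gives upper sets; with symbolic powers it gives a graded family. -/
theorem add_mem_leadExponents {J J' L : Ideal (CoordRing K n)} (h : J * J' ≤ L)
    {α β : Fin (n + 1) → ℕ} (hα : α ∈ leadExponents J) (hβ : β ∈ leadExponents J') :
    α + β ∈ leadExponents L := by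
  obtain ⟨f, hf, hf0, ⟨s, hs⟩, rfl⟩ := hα
  obtain ⟨g, hg, hg0, ⟨t, ht⟩, rfl⟩ := hβ
  refine ⟨f * g, h (Ideal.mul_mem_mul hf hg), mul_ne_zero hf0 hg0, ⟨s + t, hs.mul ht⟩, ?_⟩
  rw [MonomialOrder.degree_mul hf0 hg0, Finsupp.coe_add]

theorem leadExponents_top : leadExponents (⊤ : Ideal (CoordRing K n)) = Set.univ := by
  classical
  refine Set.eq_univ_of_forall fun α => ?_
  refine ⟨MvPolynomial.monomial (Finsupp.equivFunOnFinite.symm α) 1, trivial, by simp,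
    ⟨_, MvPolynomial.isHomogeneous_monomial 1 rfl⟩, ?_⟩
  rw [MonomialOrder.degree_monomial, if_neg one_ne_zero]
  rfl

theorem isUpperSet_leadExponents (J : Ideal (CoordRing K n)) : IsUpperSet (leadExponents J) := by
  intro α β h hα
  have h' : β - α ∈ leadExponents (⊤ : Ideal (CoordRing K n)) := by
    rw [leadExponents_top]
    trivial
  rw [← add_tsub_cancel_of_le h]
  exact add_mem_leadExponents Ideal.mul_le_left hα h'

theorem leadExponents_nonempty {J : Ideal (CoordRing K n)} (hJ : IsHomogeneousIdeal J)
    (h0 : J ≠ ⊥) : (leadExponents J).Nonempty := by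
  obtain ⟨f, hf, hf0⟩ := Submodule.exists_mem_ne_zero_of_ne_bot h0
  obtain ⟨t, ht⟩ : ∃ t, MvPolynomial.homogeneousComponent t f ≠ 0 := by
    by_contra! h
    exact hf0 (by rw [← MvPolynomial.sum_homogeneousComponent f]; simp [h])
  refine ⟨_, _, ?_, ht, ⟨t, MvPolynomial.homogeneousComponent_isHomogeneous t f⟩, rfl⟩
  -- Homogeneity of the ideal is essential here: it puts the nonzero component of `f` back into `J`.
  have h := hJ t hf
  have e := MvPolynomial.decomposition.decompose'_apply f t
  exact e ▸ h

theorem hilbertFunction_add_degreeCount (J : Ideal (CoordRing K n)) (t : ℕ) :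
    hilbertFunction J t + degreeCount (leadExponents J) t =
      degreeCount (Set.univ : Set (Fin (n + 1) → ℕ)) t := by
  rw [← leadExponents_top (K := K), ← finrank_gradedPiece, ← finrank_gradedPiece, hilbertFunction]
  have h1 := Submodule.finrank_quotient_add_finrank
    ((J.restrictScalars K).submoduleOf (MvPolynomial.homogeneousSubmodule (Fin (n + 1)) K t))
  have h2 : Module.finrank K ((J.restrictScalars K).submoduleOf
      (MvPolynomial.homogeneousSubmodule (Fin (n + 1)) K t)) =
      Module.finrank K (gradedPiece J t) := by
    rw [gradedPiece, inf_comm, ← Submodule.map_comap_subtype]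
    exact (Submodule.equivMapOfInjective _ (Submodule.subtype_injective _) _).finrank_eq
  rw [h2] at h1
  rw [h1, gradedPiece, Submodule.restrictScalars_top, top_inf_eq]

/-! ### Multiplicativity of symbolic powers -/

theorem symbolicPower_mul_le (I : Ideal (CoordRing K n)) (a b : ℕ) :
    symbolicPower I a * symbolicPower I b ≤ symbolicPower I (a + b) := by
  refine le_iInf fun Q => ?_
  have : Q.1.IsPrime := Q.2.isPrime
  refine (Ideal.mul_mono (iInf_le _ Q) (iInf_le _ Q)).trans ?_
  refine (Ideal.le_comap_mul _).trans ?_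
  rw [pow_add, Ideal.map_mul]

theorem pow_le_symbolicPower (I : Ideal (CoordRing K n)) (m : ℕ) : I ^ m ≤ symbolicPower I m :=
  le_iInf fun _ => Ideal.le_comap_map

/-- The nonzero module `R / 0` has an associated prime, and `R` embeds in the localization there
because it is a domain. The exponent `0` is excluded since `⊥ ^ 0 = ⊤`. -/
theorem symbolicPower_bot {m : ℕ} (hm : m ≠ 0) :
    symbolicPower (⊥ : Ideal (CoordRing K n)) m = ⊥ := by
  obtain ⟨Q, hQ⟩ := associatedPrimes.nonempty (CoordRing K n) (CoordRing K n ⧸ (⊥ : Ideal (CoordRing K n)))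
  have : Q.IsPrime := hQ.isPrime
  refine eq_bot_iff.2 ((iInf_le _ ⟨Q, hQ⟩).trans ?_)
  rw [Ideal.bot_pow hm, Ideal.map_bot]
  intro x hx
  rw [Ideal.mem_comap, Ideal.mem_bot] at hx
  exact (IsLocalization.to_map_eq_zero_iff _ Q.primeCompl_le_nonZeroDivisors).1 hx

/-! ### Euler characteristic of the Koszul complex -/

/-- The elements of a product of submodules are the families of elements of the factors. -/
def piSubmoduleEquiv {ι : Type*} {M : Type*} [AddCommGroup M] [Module K M]
    (p : ι → Submodule K M) : Submodule.pi Set.univ p ≃ₗ[K] (∀ i, p i) where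
  toFun x i := ⟨x.1 i, x.2 i trivial⟩
  invFun x := ⟨fun i => x i, fun i _ => (x i).2⟩
  map_add' _ _ := rfl
  map_smul' _ _ := rfl
  left_inv _ := rfl
  right_inv _ := rfl

theorem finrank_map_add_finrank_inf_ker {V W : Type*} [AddCommGroup V] [Module K V]
    [AddCommGroup W] [Module K W] (f : V →ₗ[K] W) (p : Submodule K V) [FiniteDimensional K p] :
    Module.finrank K (p.map f) + Module.finrank K (p ⊓ LinearMap.ker f : Submodule K V) =
      Module.finrank K p := by
  rw [← LinearMap.finrank_range_add_finrank_ker (f.domRestrict p), LinearMap.range_domRestrict,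
    LinearMap.ker_domRestrict, ← Submodule.map_comap_subtype]
  congr 1
  exact (Submodule.equivMapOfInjective _ (Submodule.subtype_injective _) _).finrank_eq.symm

/-- The coefficient space of `e_S` in `K_i(J)_j`. -/
abbrev koszulCoeff (J : Ideal (CoordRing K n)) (i j : ℕ) (S : Finset (Fin (n + 1))) :
    Submodule K (CoordRing K n) :=
  if S.card = i ∧ i ≤ j then gradedPiece J (j - i) else ⊥

instance (J : Ideal (CoordRing K n)) (i j : ℕ) (S : Finset (Fin (n + 1))) :
    FiniteDimensional K (koszulCoeff J i j S) := by
  have h : koszulCoeff J i j S ≤ gradedPiece J (j - i) := by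
    unfold koszulCoeff
    split_ifs
    exacts [le_rfl, bot_le]
  exact Submodule.finiteDimensional_of_le h

theorem koszulChains_eq_pi (J : Ideal (CoordRing K n)) (i j : ℕ) :
    koszulChains J i j = Submodule.pi Set.univ (koszulCoeff J i j) := rfl

instance (J : Ideal (CoordRing K n)) (i j : ℕ) : FiniteDimensional K (koszulChains J i j) :=
  Module.Finite.equiv (piSubmoduleEquiv (koszulCoeff J i j)).symm

theorem finrank_koszulChains (J : Ideal (CoordRing K n)) (i j : ℕ) :
    Module.finrank K (koszulChains J i j) = ∑ S : Finset (Fin (n + 1)),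
      if S.card = i then (if i ≤ j then Module.finrank K (gradedPiece J (j - i)) else 0) else 0 := by
  rw [koszulChains_eq_pi, (piSubmoduleEquiv (koszulCoeff J i j)).finrank_eq,
    Module.finrank_pi_fintype]
  refine Finset.sum_congr rfl fun S _ => ?_
  by_cases h : S.card = i ∧ i ≤ j
  · rw [show koszulCoeff J i j S = _ from if_pos h, if_pos h.1, if_pos h.2]
  · rw [show koszulCoeff J i j S = ⊥ from if_neg h, finrank_bot, ← ite_and, if_neg h]

theorem koszulChains_eq_bot (J : Ideal (CoordRing K n)) {i : ℕ} (j : ℕ) (hi : n + 1 < i) :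
    koszulChains J i j = ⊥ := by
  rw [← Submodule.finrank_eq_zero (R := K), finrank_koszulChains]
  refine Finset.sum_eq_zero fun S _ => if_neg fun h => ?_
  have := S.card_le_univ
  rw [Fintype.card_fin] at this
  omega

theorem koszulCycles_zero (J : Ideal (CoordRing K n)) (j : ℕ) :
    koszulCycles J 0 j = koszulChains J 0 j := by
  refine inf_eq_left.2 fun ω hω => ?_
  rw [LinearMap.mem_ker]
  funext T
  change (∑ k ∈ Tᶜ, koszulSign T k • (MvPolynomial.X k * ω (insert k T))) = 0
  refine Finset.sum_eq_zero fun k _ => ?_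
  have h := hω (insert k T) trivial
  simp only [Finset.card_eq_zero, Finset.insert_ne_empty, false_and, if_false] at h
  rw [h, mul_zero, smul_zero]

/-- If the Koszul homology of `J` vanishes in internal degree `j`, then the Euler characteristic of
the Koszul complex vanishes in that degree. -/
theorem sum_neg_one_pow_mul_finrank_eq_zero (J : Ideal (CoordRing K n)) (j : ℕ)
    (h : ∀ i, ¬ Nontrivial (koszulHomology J i j)) :
    ∑ S : Finset (Fin (n + 1)), (-1 : ℚ) ^ S.card *
      (if S.card ≤ j then (Module.finrank K (gradedPiece J (j - S.card)) : ℚ) else 0) = 0 := by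
  set z : ℕ → ℕ := fun i => Module.finrank K (koszulCycles J i j) with hz
  set c : ℕ → ℕ := fun i => Module.finrank K (koszulChains J i j) with hc
  have hb : ∀ i, koszulBoundaries J i j = koszulCycles J i j := by
    intro i
    have h' := h i
    rw [Submodule.Quotient.nontrivial_iff, not_not, Submodule.submoduleOf,
      Submodule.comap_subtype_eq_top] at h'
    exact le_antisymm (koszulBoundaries_le_koszulCycles J i j) h'
  -- Rank–nullity for the differential on `K_{i+1}(J)_j`, whose image is the whole space of cycles
  -- of homological degree `i` by exactness.
  have hstep : ∀ i, c (i + 1) = z i + z (i + 1) := fun i => by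
    simp only [hc, hz]
    rw [← hb i]
    exact (finrank_map_add_finrank_inf_ker (koszulD K n) (koszulChains J (i + 1) j)).symm
  have h0 : c 0 = z 0 := by
    simp only [hc, hz]
    rw [koszulCycles_zero]
  have halt : ∀ N, ∑ i ∈ Finset.range (N + 1), (-1 : ℚ) ^ i * c i = (-1) ^ N * z N := by
    intro N
    induction N with
    | zero => simp [h0]
    | succ N ih =>
      rw [Finset.sum_range_succ, ih, hstep]
      push_cast
      ring
  -- The alternating sum telescopes to its last cycle term, which is zero past the length `n + 1` of
  -- the complex.
  have hz0 : z (n + 2) = 0 := by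
    refine Nat.eq_zero_of_le_zero ?_
    have : c (n + 2) = 0 := by
      simp only [hc]
      rw [koszulChains_eq_bot J j (by omega), finrank_bot]
    have : c (n + 2) = z (n + 1) + z (n + 2) := hstep (n + 1)
    omega
  have hsum := halt (n + 2)
  rw [hz0, Nat.cast_zero, mul_zero] at hsum
  refine Eq.trans (Eq.symm ?_) hsum
  simp only [hc, finrank_koszulChains]
  push_cast
  simp only [Finset.mul_sum]
  rw [Finset.sum_comm]
  refine Finset.sum_congr rfl fun S _ => ?_
  have hS := S.card_le_univ
  rw [Fintype.card_fin] at hS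
  rw [Finset.sum_eq_single S.card]
  · simp
  · intro i _ hi
    rw [if_neg (Ne.symm hi), mul_zero]
  · intro hn
    exact absurd (Finset.mem_range.2 (by omega)) hn

/-- Nonzero homology in bidegree `(i, j)` forces `j ≤ r + i`, and the complex lives in `i ≤ n + 1`;
this is the origin of the shift `n + 1`. -/
theorem not_nontrivial_koszulHomology {J : Ideal (CoordRing K n)} {r : ℝ}
    (hr : regularity J ≤ (r : EReal)) {j : ℕ} (hj : r + n + 1 < j) (i : ℕ) :
    ¬ Nontrivial (koszulHomology J i j) := by
  intro hnt
  by_cases hi : n + 1 < i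
  · rw [Submodule.Quotient.nontrivial_iff] at hnt
    refine hnt ?_
    rw [Submodule.submoduleOf, Submodule.comap_subtype_eq_top, koszulCycles,
      koszulChains_eq_bot J j hi, bot_inf_eq]
    exact bot_le
  · have h : (((j : ℝ) - (i : ℝ) : ℝ) : EReal) ≤ r := by
      refine le_trans (le_iSup_of_le i (le_iSup_of_le j ?_)) hr
      exact le_iSup (fun _ : Nontrivial (koszulHomology J i j) =>
        (((j : ℝ) - (i : ℝ) : ℝ) : EReal)) hnt
    rw [EReal.coe_le_coe_iff] at h
    have : (i : ℝ) ≤ n + 1 := by exact_mod_cast not_lt.1 hi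
    linarith

/-! ### Hilbert series, Hilbert polynomial and regularity -/

/-- Expanding `(1 - X) ^ k` over subsets rather than with binomial coefficients makes the numerator
coefficients match the Koszul Euler characteristic term by term. -/
theorem coeff_mul_one_sub_X_pow (F : PowerSeries ℚ) (k j : ℕ) :
    PowerSeries.coeff j (F * (1 - PowerSeries.X) ^ k) =
      ∑ S : Finset (Fin k), (-1 : ℚ) ^ S.card *
        (if S.card ≤ j then PowerSeries.coeff (j - S.card) F else 0) := by
  have h : (1 - PowerSeries.X : PowerSeries ℚ) ^ k =
      ∑ S : Finset (Fin k), (-PowerSeries.X) ^ S.card := by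
    rw [sub_eq_neg_add, ← Fin.sum_pow_mul_eq_add_pow]
    simp
  rw [h, Finset.mul_sum, map_sum]
  refine Finset.sum_congr rfl fun S _ => ?_
  rw [neg_pow, mul_left_comm, ← PowerSeries.coeff_mul_X_pow', ← PowerSeries.coeff_C_mul]
  simp

/-- The Hilbert series of the polynomial ring is `1 / (1 - X) ^ k`. -/
theorem mk_degreeCount_univ_mul (k : ℕ) :
    PowerSeries.mk (fun t => (degreeCount (Set.univ : Set (Fin k → ℕ)) t : ℚ)) *
      (1 - PowerSeries.X : PowerSeries ℚ) ^ k = 1 := by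
  induction k with
  | zero =>
    ext t
    rw [pow_zero, mul_one, PowerSeries.coeff_mk, PowerSeries.coeff_one]
    split_ifs with h
    · have : {α ∈ (Set.univ : Set (Fin 0 → ℕ)) | ∑ i, α i = t} = {0} := by
        ext α
        simp [h, eq_iff_true_of_subsingleton]
      rw [degreeCount, this, Set.ncard_singleton, Nat.cast_one]
    · have : {α ∈ (Set.univ : Set (Fin 0 → ℕ)) | ∑ i, α i = t} = ∅ := by
        ext α
        simp [Ne.symm h]
      rw [degreeCount, this, Set.ncard_empty, Nat.cast_zero]
  | succ k ih =>
    have key : PowerSeries.mk (fun t => (degreeCount (Set.univ : Set (Fin (k + 1) → ℕ)) t : ℚ)) =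
        PowerSeries.mk 1 *
          PowerSeries.mk (fun t => (degreeCount (Set.univ : Set (Fin k → ℕ)) t : ℚ)) := by
      ext t
      rw [PowerSeries.coeff_mk, degreeCount_succ, PowerSeries.coeff_mul,
        Finset.Nat.sum_antidiagonal_eq_sum_range_succ_mk]
      simp only [PowerSeries.coeff_mk, Pi.one_apply, one_mul, Set.mem_univ]
      push_cast
      rfl
    have h1 : (PowerSeries.mk 1 : PowerSeries ℚ) * (1 - PowerSeries.X) = 1 :=
      PowerSeries.mk_one_mul_one_sub_eq_one ℚ
    rw [key, pow_succ', mul_mul_mul_comm, h1, one_mul, ih]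

/-- If the numerator of the generating function of the leading exponents of `J` is `p`, then that
of the Hilbert series of `J` is `1 - p`. -/
theorem mk_hilbertFunction_mul {J : Ideal (CoordRing K n)} {p : ℚ[X]}
    (hp : PowerSeries.mk (fun t => (degreeCount (leadExponents J) t : ℚ)) *
      (1 - PowerSeries.X : PowerSeries ℚ) ^ (n + 1) = (p : PowerSeries ℚ)) :
    PowerSeries.mk (fun t => (hilbertFunction J t : ℚ)) *
      (1 - PowerSeries.X : PowerSeries ℚ) ^ (n + 1) = ((1 - p : ℚ[X]) : PowerSeries ℚ) := by
  have h : PowerSeries.mk (fun t => (hilbertFunction J t : ℚ)) =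
      PowerSeries.mk (fun t => (degreeCount (Set.univ : Set (Fin (n + 1) → ℕ)) t : ℚ)) -
        PowerSeries.mk (fun t => (degreeCount (leadExponents J) t : ℚ)) := by
    ext t
    rw [map_sub, PowerSeries.coeff_mk, PowerSeries.coeff_mk, PowerSeries.coeff_mk,
      ← hilbertFunction_add_degreeCount J t]
    push_cast
    ring
  rw [h, sub_mul, mk_degreeCount_univ_mul, hp, Polynomial.coe_sub, Polynomial.coe_one]

theorem eval_hilbertPoly_eq_hilbertFunction {J : Ideal (CoordRing K n)} {p : ℚ[X]}
    (hp : PowerSeries.mk (fun t => (hilbertFunction J t : ℚ)) *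
      (1 - PowerSeries.X : PowerSeries ℚ) ^ (n + 1) = (p : PowerSeries ℚ))
    {t : ℕ} (ht : p.natDegree < t) :
    (hilbertPoly p (n + 1)).eval (t : ℚ) = hilbertFunction J t := by
  rw [← coeff_mul_invOneSubPow_eq_hilbertPoly_eval (n + 1) ht, ← hp, mul_assoc,
    ← PowerSeries.invOneSubPow_inv_eq_one_sub_pow, Units.inv_val, mul_one, PowerSeries.coeff_mk]

theorem natDegree_hilbertPoly_succ_le (p : ℚ[X]) (d : ℕ) :
    (hilbertPoly p (d + 1)).natDegree ≤ d := by
  rw [hilbertPoly_succ]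
  refine natDegree_sum_le_of_forall_le _ _ fun i _ => (natDegree_smul_le _ _).trans ?_
  rw [natDegree_preHilbertPoly]

/-- Every ideal has a Hilbert polynomial, of degree at most `n`. -/
theorem exists_isHilbertPolynomial (J : Ideal (CoordRing K n)) :
    ∃ p : ℚ[X], IsHilbertPolynomial J p ∧ p.natDegree ≤ n := by
  obtain ⟨p, hp⟩ := exists_mk_degreeCount_mul_eq_coe (n + 1) _ (isUpperSet_leadExponents J)
  refine ⟨hilbertPoly (1 - p) (n + 1), ?_, natDegree_hilbertPoly_succ_le _ _⟩
  filter_upwards [eventually_gt_atTop (1 - p).natDegree] with t ht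
  exact eval_hilbertPoly_eq_hilbertFunction (mk_hilbertFunction_mul hp) ht

theorem natDegree_hilbertPolynomial_le (J : Ideal (CoordRing K n)) :
    (hilbertPolynomial J).natDegree ≤ n := by
  obtain ⟨p, hp, hdeg⟩ := exists_isHilbertPolynomial J
  rwa [hp.eq_hilbertPolynomial]

/-- The Hilbert function agrees with the Hilbert polynomial in degrees beyond the regularity. -/
theorem eval_hilbertPolynomial_of_regularity_le {J : Ideal (CoordRing K n)} {r : ℝ}
    (hr : regularity J ≤ (r : EReal)) {t : ℕ} (h0 : 0 < t) (ht : r + n + 1 < t) :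
    (hilbertPolynomial J).eval (t : ℚ) = hilbertFunction J t := by
  obtain ⟨p, hp⟩ := exists_mk_degreeCount_mul_eq_coe (n + 1) _ (isUpperSet_leadExponents J)
  have hpH := mk_hilbertFunction_mul hp
  have hP : IsHilbertPolynomial J (hilbertPoly (1 - p) (n + 1)) := by
    filter_upwards [eventually_gt_atTop (1 - p).natDegree] with t ht
    exact eval_hilbertPoly_eq_hilbertFunction hpH ht
  rw [hP.eq_hilbertPolynomial]
  refine eval_hilbertPoly_eq_hilbertFunction hpH ?_
  -- These coefficients are Euler characteristics of exact strands of the Koszul complex.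
  have hcoeff : ∀ j, t ≤ j → p.coeff j = 0 := by
    intro j hj
    rw [← Polynomial.coeff_coe, ← hp, coeff_mul_one_sub_X_pow]
    have hj' : r + n + 1 < j := ht.trans_le (by exact_mod_cast hj)
    have := sum_neg_one_pow_mul_finrank_eq_zero J j (not_nontrivial_koszulHomology hr hj')
    simpa only [PowerSeries.coeff_mk, finrank_gradedPiece] using this
  -- The numerator is `1 - p`, so `0 < t` is needed to keep the constant term `1` below degree `t`.
  refine Nat.lt_of_le_pred h0 (natDegree_le_iff_coeff_eq_zero.2 fun N hN => ?_)
  rw [Nat.pred_eq_sub_one] at hN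
  rw [coeff_sub, hcoeff N (by omega), coeff_one, if_neg (by omega), sub_zero]

/-! ### Limiting shapes of graded families -/

/-- A graded family of upper sets of exponents, i.e. of monomial ideals. -/
structure IsGradedFamily {d : ℕ} (A : ℕ → Set (Fin d → ℕ)) : Prop where
  isUpperSet : ∀ m, IsUpperSet (A m)
  add_mem : ∀ {a b : ℕ} {α β : Fin d → ℕ}, α ∈ A a → β ∈ A b → α + β ∈ A (a + b)

/-- The (open) limiting shape of a graded family of monomial ideals. -/
def limitShape {d : ℕ} (A : ℕ → Set (Fin d → ℕ)) : Set (Fin d → ℝ) :=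
  {x | ∃ k : ℕ, 1 ≤ k ∧ ∃ α ∈ A k, ∀ i, (α i : ℝ) < k * x i}

theorem isOpen_limitShape {d : ℕ} (A : ℕ → Set (Fin d → ℕ)) : IsOpen (limitShape A) := by
  have : limitShape A = ⋃ (k : ℕ) (_ : 1 ≤ k) (α ∈ A k),
      ⋂ i, {x : Fin d → ℝ | (α i : ℝ) < k * x i} := by
    ext x
    simp [limitShape]
  rw [this]
  refine isOpen_iUnion fun k => isOpen_iUnion fun _ => isOpen_iUnion fun α => isOpen_iUnion fun _ =>
    isOpen_iInter_of_finite fun i => isOpen_lt continuous_const (by fun_prop)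

theorem pos_of_mem_limitShape {d : ℕ} {A : ℕ → Set (Fin d → ℕ)} {x : Fin d → ℝ}
    (hx : x ∈ limitShape A) (i : Fin d) : 0 < x i := by
  obtain ⟨k, hk, α, -, h⟩ := hx
  have h1 : (0 : ℝ) < k := by exact_mod_cast hk
  exact pos_of_mul_pos_right ((Nat.cast_nonneg _).trans_lt (h i)) h1.le

namespace IsGradedFamily

variable {d : ℕ} {A : ℕ → Set (Fin d → ℕ)}

theorem nsmul_mem (hA : IsGradedFamily A) {k : ℕ} {α : Fin d → ℕ} (hα : α ∈ A k) {c : ℕ}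
    (hc : 1 ≤ c) : c • α ∈ A (c * k) := by
  induction c, hc using Nat.le_induction with
  | base => simpa using hα
  | succ c _ ih =>
    rw [succ_nsmul, add_mul, one_mul]
    exact hA.add_mem ih hα

theorem add_nsmul_mem (hA : IsGradedFamily A) {k : ℕ} {α γ : Fin d → ℕ} (hα : α ∈ A k)
    (hγ : γ ∈ A 1) (r : ℕ) : α + r • γ ∈ A (k + r) := by
  induction r with
  | zero => simpa using hα
  | succ r ih =>
    rw [succ_nsmul, ← add_assoc, ← add_assoc]
    exact hA.add_mem ih hγ

theorem convex_limitShape (hA : IsGradedFamily A) : Convex ℝ (limitShape A) := by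
  refine convex_iff_forall_pos.2 fun x hx y hy a b ha hb hab => ?_
  obtain ⟨k, hk, α, hα, hx⟩ := hx
  obtain ⟨l, hl, β, hβ, hy⟩ := hy
  have hk0 : (0 : ℝ) < k := by exact_mod_cast hk
  have hl0 : (0 : ℝ) < l := by exact_mod_cast hl
  -- The inequalities are strict, so with the target point fixed the weight `a` may be replaced by a
  -- nearby rational `p / q`. Then `p l α + (q - p) k β` lies in the member of index `q k l`, as
  -- required.
  set O : Set ℝ := Set.Ioo 0 1 ∩
    ⋂ i, {s | s * (l * α i) + (1 - s) * (k * β i) < k * l * (a * x i + b * y i)} with hO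
  have hOo : IsOpen O := isOpen_Ioo.inter
    (isOpen_iInter_of_finite fun i => isOpen_lt (by fun_prop) continuous_const)
  have haO : a ∈ O := by
    refine ⟨⟨ha, by linarith⟩, Set.mem_iInter.2 fun i => ?_⟩
    have h1 := mul_lt_mul_of_pos_left (hx i) (mul_pos ha hl0)
    have h2 := mul_lt_mul_of_pos_left (hy i) (mul_pos hb hk0)
    have h3 : (1 - a) = b := by linarith
    simp only [Set.mem_ofPred_eq, h3]
    linarith
  obtain ⟨r, ⟨hr0, hr1⟩, hr⟩ := Rat.denseRange_cast.exists_mem_open hOo ⟨a, haO⟩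
  have hr0' : 0 < r := by exact_mod_cast hr0
  have hr1' : r < 1 := by exact_mod_cast hr1
  obtain ⟨p, hp⟩ := Int.eq_ofNat_of_zero_le (Rat.num_nonneg.2 hr0'.le)
  have hq0 : (0 : ℝ) < r.den := by exact_mod_cast r.den_pos
  have hrq : (r : ℝ) * r.den = p := by
    have := Rat.mul_den_eq_num r
    rw [hp] at this
    exact_mod_cast this
  have hp0 : 0 < p := by
    have : (0 : ℝ) < p := by rw [← hrq]; positivity
    exact_mod_cast this
  have hpq : p < r.den := by
    have : (p : ℝ) < r.den := by rw [← hrq]; nlinarith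
    exact_mod_cast this
  obtain ⟨s, hs⟩ := Nat.exists_eq_add_of_lt hpq
  have hsq : (r.den : ℝ) = p + s + 1 := by exact_mod_cast hs
  refine ⟨(p * l) * k + ((s + 1) * k) * l, by nlinarith [Nat.mul_pos (Nat.mul_pos hp0 hl) hk],
    (p * l) • α + ((s + 1) * k) • β, hA.add_mem (hA.nsmul_mem hα (Nat.mul_pos hp0 hl))
      (hA.nsmul_mem hβ (Nat.mul_pos s.succ_pos hk)), fun i => ?_⟩
  have h := mul_lt_mul_of_pos_right (Set.mem_iInter.1 hr i) hq0
  have e1 : ((r : ℝ) * (l * α i) + (1 - r) * (k * β i)) * r.den =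
      p * l * α i + (s + 1) * k * β i := by
    have : (1 - (r : ℝ)) * r.den = s + 1 := by linarith
    calc _ = (r * r.den : ℝ) * (l * α i) + ((1 - r) * r.den) * (k * β i) := by ring
      _ = _ := by rw [hrq, this]; ring
  rw [e1, hsq] at h
  simp only [Pi.add_apply, Pi.smul_apply, smul_eq_mul]
  push_cast
  linarith

/-- Lattice points near `m • x`, with `x` in the limiting shape, lie in `A m` for large `m`. -/
theorem eventually_mem (hA : IsGradedFamily A) {γ : Fin d → ℕ} (hγ : γ ∈ A 1) {x : Fin d → ℝ}
    (hx : x ∈ limitShape A) :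
    ∀ᶠ m : ℕ in atTop, ∀ δ : Fin d → ℕ, (∀ i, m * x i - 1 ≤ δ i) → δ ∈ A m := by
  obtain ⟨k, hk, α, hα, hx⟩ := hx
  have hk0 : (0 : ℝ) < k := by exact_mod_cast hk
  -- With `m = q k + r`, the candidate is `q α + r γ`, where `γ` absorbs the remainder. After
  -- multiplication by `k` it costs at most `m α + k ^ 2 γ`, and the bound asks that this be at most
  -- `k (m x - 1)`.
  have hlarge : ∀ i, ∀ᶠ m : ℕ in atTop, (k * (k * γ i + 1) : ℝ) ≤ m * (k * x i - α i) := fun i =>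
    (tendsto_natCast_atTop_atTop.atTop_mul_const (sub_pos.2 (hx i))).eventually_ge_atTop _
  filter_upwards [eventually_all.2 hlarge, eventually_ge_atTop k] with m hm hmk δ hδ
  -- The quotient must be positive, since `0 ∈ A 0` is not assumed.
  have hq : 1 ≤ m / k := (Nat.one_le_div_iff hk).2 hmk
  have hmem := hA.add_nsmul_mem (hA.nsmul_mem hα hq) hγ (m % k)
  rw [mul_comm, Nat.div_add_mod] at hmem
  refine hA.isUpperSet m (fun i => ?_) hmem
  have h1 : ((m / k : ℕ) : ℝ) * k ≤ m := by exact_mod_cast Nat.div_mul_le_self m k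
  have h2 : ((m % k : ℕ) : ℝ) ≤ k := by exact_mod_cast (Nat.mod_lt m hk).le
  have h3 : (α i : ℝ) * (((m / k : ℕ) : ℝ) * k) ≤ α i * m :=
    mul_le_mul_of_nonneg_left h1 (Nat.cast_nonneg _)
  have h4 : (γ i : ℝ) * ((m % k : ℕ) : ℝ) ≤ γ i * k :=
    mul_le_mul_of_nonneg_left h2 (Nat.cast_nonneg _)
  have h5 : (k : ℝ) * ((m / k : ℕ) * α i + (m % k : ℕ) * γ i) ≤ k * δ i := by
    have := mul_le_mul_of_nonneg_left (hδ i) hk0.le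
    have := mul_le_mul_of_nonneg_left h4 hk0.le
    linarith [hm i]
  have h6 := le_of_mul_le_mul_left h5 hk0
  simp only [Pi.add_apply, Pi.smul_apply, smul_eq_mul]
  exact_mod_cast h6

end IsGradedFamily

/-! ### Slices of the limiting shape and lattice-point counts -/

/-- The parametrisation of the hyperplane of vectors with coordinate sum `t` by all coordinates but
the first. -/
def sliceMap {n : ℕ} (t : ℝ) (y : Fin n → ℝ) : Fin (n + 1) → ℝ :=
  Fin.cons (t - ∑ i, y i) y

theorem continuous_sliceMap {n : ℕ} (t : ℝ) : Continuous (sliceMap t : (Fin n → ℝ) → _) := by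
  refine continuous_pi fun i => ?_
  refine Fin.cases ?_ (fun i => ?_) i
  · simp only [sliceMap, Fin.cons_zero]
    fun_prop
  · simp only [sliceMap, Fin.cons_succ]
    fun_prop

theorem sliceMap_combo {n : ℕ} (t : ℝ) (y z : Fin n → ℝ) {a b : ℝ} (hab : a + b = 1) :
    sliceMap t (a • y + b • z) = a • sliceMap t y + b • sliceMap t z := by
  funext i
  refine Fin.cases ?_ (fun i => ?_) i
  · simp only [sliceMap, Fin.cons_zero, Pi.add_apply, Pi.smul_apply, smul_eq_mul,
      Finset.sum_add_distrib, ← Finset.mul_sum]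
    linear_combination -t * hab
  · simp [sliceMap]

/-- The slice of the limiting shape by the hyperplane of vectors with coordinate sum `t`. -/
def limitSlice {n : ℕ} (A : ℕ → Set (Fin (n + 1) → ℕ)) (t : ℝ) : Set (Fin n → ℝ) :=
  sliceMap t ⁻¹' limitShape A

theorem isOpen_limitSlice {n : ℕ} (A : ℕ → Set (Fin (n + 1) → ℕ)) (t : ℝ) :
    IsOpen (limitSlice A t) :=
  (isOpen_limitShape A).preimage (continuous_sliceMap t)

/-- The exponents of degree `m * t` in `A m`, with the first coordinate dropped. -/
def sliceExponents {n : ℕ} (A : ℕ → Set (Fin (n + 1) → ℕ)) (t m : ℕ) : Set (Fin n → ℕ) :=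
  {β | ∑ i, β i ≤ m * t ∧ (Fin.cons (m * t - ∑ i, β i) β : Fin (n + 1) → ℕ) ∈ A m}

/-- The union of the cells of side `1 / m` that belong to `sliceExponents A t m`. -/
def sliceCells {n : ℕ} (A : ℕ → Set (Fin (n + 1) → ℕ)) (t m : ℕ) : Set (Fin n → ℝ) :=
  ⋃ β ∈ sliceExponents A t m, Set.pi Set.univ fun i => Set.Ico ((β i : ℝ) / m) ((β i + 1) / m)

section

variable {n : ℕ} {A : ℕ → Set (Fin (n + 1) → ℕ)} {t m : ℕ}

theorem finite_sliceExponents : (sliceExponents A t m).Finite :=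
  (Set.finite_Iic (fun _ : Fin n => m * t)).subset fun _ hβ i =>
    (Finset.single_le_sum (fun _ _ => Nat.zero_le _) (Finset.mem_univ i)).trans hβ.1

theorem ncard_sliceExponents : (sliceExponents A t m).ncard = degreeCount (A m) (m * t) := by
  rw [degreeCount, ← Set.InjOn.ncard_image (s := sliceExponents A t m)
    (f := fun β => (Fin.cons (m * t - ∑ i, β i) β : Fin (n + 1) → ℕ))
    fun β _ γ _ h => (Fin.cons_inj.1 h).2]
  congr 1
  ext α
  constructor
  · rintro ⟨β, ⟨hs, hβ⟩, rfl⟩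
    refine ⟨hβ, ?_⟩
    rw [Fin.sum_cons]
    omega
  · rintro ⟨hα, hs⟩
    rw [Fin.sum_univ_succ] at hs
    have h : (Fin.cons (m * t - ∑ i, Fin.tail α i) (Fin.tail α) : Fin (n + 1) → ℕ) = α := by
      rw [← Fin.cons_self_tail α]
      simp only [Fin.tail_cons]
      congr 1
      simp only [Fin.tail]
      omega
    refine ⟨Fin.tail α, ⟨?_, ?_⟩, h⟩
    · simp only [Fin.tail]
      omega
    · rw [h]
      exact hα

theorem mem_cell_iff (hm : 0 < m) (β : Fin n → ℕ) (y : Fin n → ℝ) :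
    y ∈ (Set.pi Set.univ fun i => Set.Ico ((β i : ℝ) / m) ((β i + 1) / m)) ↔
      ∀ i, (β i : ℝ) ≤ m * y i ∧ m * y i < β i + 1 := by
  have hm' : (0 : ℝ) < m := by exact_mod_cast hm
  simp only [Set.mem_pi, Set.mem_univ, true_imp_iff, Set.mem_Ico, div_le_iff₀ hm', lt_div_iff₀ hm',
    mul_comm (m : ℝ)]

theorem mem_sliceCells_iff (hm : 0 < m) (y : Fin n → ℝ) :
    y ∈ sliceCells A t m ↔
      ∃ β ∈ sliceExponents A t m, ∀ i, (β i : ℝ) ≤ m * y i ∧ m * y i < β i + 1 := by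
  simp only [sliceCells, Set.mem_iUnion, exists_prop, mem_cell_iff hm]

theorem measurableSet_sliceCells : MeasurableSet (sliceCells A t m) :=
  finite_sliceExponents.measurableSet_biUnion fun _ _ =>
    MeasurableSet.univ_pi fun _ => measurableSet_Ico

/-- The cells are disjoint half-open cubes of volume `m ^ (-n)`, one for each exponent counted. -/
theorem volume_sliceCells (hm : 0 < m) :
    (MeasureTheory.volume (sliceCells A t m)).toReal =
      (degreeCount (A m) (m * t) : ℝ) / (m : ℝ) ^ n := by
  have hm' : (0 : ℝ) < m := by exact_mod_cast hm
  have hcell : ∀ β : Fin n → ℕ, (MeasureTheory.volume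
      (Set.pi Set.univ fun i => Set.Ico ((β i : ℝ) / m) ((β i + 1) / m))).toReal =
        ((m : ℝ) ^ n)⁻¹ := by
    intro β
    rw [Real.volume_pi_Ico_toReal fun i => div_le_div_of_nonneg_right (by linarith) hm'.le]
    simp only [← sub_div, add_sub_cancel_left, one_div, Finset.prod_const, Finset.card_univ,
      Fintype.card_fin, inv_pow]
  have hunion : sliceCells A t m = ⋃ β ∈ (finite_sliceExponents (A := A) (t := t) (m := m)).toFinset,
      Set.pi Set.univ fun i => Set.Ico ((β i : ℝ) / m) ((β i + 1) / m) := by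
    simp only [sliceCells, Set.Finite.mem_toFinset]
  rw [hunion, MeasureTheory.measure_biUnion_finset, ENNReal.toReal_sum]
  · rw [Finset.sum_congr rfl fun β _ => hcell β, Finset.sum_const, nsmul_eq_mul,
      ← Set.ncard_eq_toFinset_card _ finite_sliceExponents, ncard_sliceExponents, div_eq_mul_inv]
  · intro β _
    rw [Real.volume_pi_Ico]
    exact ENNReal.prod_ne_top fun _ _ => ENNReal.ofReal_ne_top
  · intro β _ β' _ hne
    rw [Function.onFun, Set.disjoint_left]
    intro y hy hy'
    rw [mem_cell_iff hm] at hy hy'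
    refine hne (funext fun i => ?_)
    have h1 : (β i : ℝ) < β' i + 1 := (hy i).1.trans_lt (hy' i).2
    have h2 : (β' i : ℝ) < β i + 1 := (hy' i).1.trans_lt (hy i).2
    have h1' : β i < β' i + 1 := by exact_mod_cast h1
    have h2' : β' i < β i + 1 := by exact_mod_cast h2
    omega
  · exact fun _ _ => MeasurableSet.univ_pi fun _ => measurableSet_Ico

theorem sliceCells_subset (hm : 0 < m) :
    sliceCells A t m ⊆ Set.Icc 0 (fun _ => (t : ℝ) + 1) := by
  intro y hy
  obtain ⟨β, ⟨hs, -⟩, hβ⟩ := (mem_sliceCells_iff hm y).1 hy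
  have hm' : (0 : ℝ) < m := by exact_mod_cast hm
  have hm1 : (1 : ℝ) ≤ m := by exact_mod_cast hm
  refine ⟨fun i => ?_, fun i => ?_⟩
  · exact nonneg_of_mul_nonneg_right ((Nat.cast_nonneg _).trans (hβ i).1) hm'
  · have h : β i ≤ m * t :=
      (Finset.single_le_sum (fun _ _ => Nat.zero_le _) (Finset.mem_univ i)).trans hs
    have h' : (β i : ℝ) ≤ m * t := by exact_mod_cast h
    refine le_of_mul_le_mul_left ?_ hm'
    nlinarith [(hβ i).2]

theorem limitSlice_subset : limitSlice A t ⊆ Set.Icc 0 (fun _ => (t : ℝ) + 1) := by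
  intro y hy
  have hpos : ∀ i : Fin n, 0 < y i := fun i => by
    simpa [sliceMap] using pos_of_mem_limitShape hy i.succ
  have h0 : 0 < (t : ℝ) - ∑ i, y i := by
    simpa [sliceMap] using pos_of_mem_limitShape hy 0
  refine ⟨fun i => (hpos i).le, fun i => ?_⟩
  have := Finset.single_le_sum (f := y) (fun i _ => (hpos i).le) (Finset.mem_univ i)
  simp only
  linarith

/-- Rounding `m • y` down loses less than `1` in each coordinate and only raises the remaining first
coordinate, which is within the slack allowed by `eventually_mem`. -/
theorem IsGradedFamily.eventually_mem_sliceCells (hA : IsGradedFamily A) {γ : Fin (n + 1) → ℕ}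
    (hγ : γ ∈ A 1) {y : Fin n → ℝ} (hy : y ∈ limitSlice A t) :
    ∀ᶠ m in atTop, y ∈ sliceCells A t m := by
  have hpos : ∀ i : Fin n, 0 < y i := fun i => by
    simpa [sliceMap] using pos_of_mem_limitShape hy i.succ
  have h0 : 0 < (t : ℝ) - ∑ i, y i := by
    simpa [sliceMap] using pos_of_mem_limitShape hy 0
  filter_upwards [hA.eventually_mem hγ hy, eventually_gt_atTop 0] with m hm hm0
  have hm' : (0 : ℝ) < m := by exact_mod_cast hm0
  have hle : ∀ i, (⌊m * y i⌋₊ : ℝ) ≤ m * y i := fun i => Nat.floor_le (by have := hpos i; positivity)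
  have hlt : ∀ i, m * y i < ⌊m * y i⌋₊ + 1 := fun i => Nat.lt_floor_add_one _
  have hsum : ∑ i, (⌊m * y i⌋₊ : ℝ) ≤ m * ∑ i, y i := by
    rw [Finset.mul_sum]
    exact Finset.sum_le_sum fun i _ => hle i
  have hsum' : ∑ i, ⌊m * y i⌋₊ ≤ m * t := by
    have : ∑ i, (⌊m * y i⌋₊ : ℝ) ≤ m * t := hsum.trans (by nlinarith)
    exact_mod_cast this
  refine (mem_sliceCells_iff hm0 y).2 ⟨fun i => ⌊m * y i⌋₊, ⟨hsum', hm _ fun i => ?_⟩,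
    fun i => ⟨hle i, hlt i⟩⟩
  refine Fin.cases ?_ (fun i => ?_) i
  · simp only [sliceMap, Fin.cons_zero]
    rw [Nat.cast_sub hsum']
    push_cast
    nlinarith
  · simp only [sliceMap, Fin.cons_succ]
    linarith [hlt i]

/-- The cell containing `y` has its corner below `m • y`; the rounding errors accumulate in the
first coordinate, to at most `n`, and `m * ε > n` absorbs them. -/
theorem add_mem_limitShape_of_frequently {y : Fin n → ℝ}
    (hy : ∃ᶠ m in atTop, y ∈ sliceCells A t m) {ε : ℝ} (hε : 0 < ε) :
    (fun i => sliceMap t y i + ε) ∈ limitShape A := by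
  have hev : ∀ᶠ m : ℕ in atTop, (n : ℝ) < m * ε :=
    (tendsto_natCast_atTop_atTop.atTop_mul_const hε).eventually_gt_atTop _
  obtain ⟨m, hmem, hm, hm0⟩ := (hy.and_eventually (hev.and (eventually_gt_atTop 0))).exists
  have hm' : (0 : ℝ) < m := by exact_mod_cast hm0
  obtain ⟨β, ⟨hs, hβA⟩, hβ⟩ := (mem_sliceCells_iff hm0 y).1 hmem
  refine ⟨m, hm0, _, hβA, fun i => ?_⟩
  refine Fin.cases ?_ (fun i => ?_) i
  · have h : m * ∑ i, y i ≤ ∑ i, (β i : ℝ) + n := by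
      rw [Finset.mul_sum]
      refine (Finset.sum_le_sum fun i _ => (hβ i).2.le).trans_eq ?_
      simp [Finset.sum_add_distrib]
    simp only [sliceMap, Fin.cons_zero]
    rw [Nat.cast_sub hs]
    push_cast
    linarith
  · simp only [sliceMap, Fin.cons_succ]
    have := mul_pos hm' hε
    linarith [(hβ i).1]

theorem IsGradedFamily.convex_limitSlice (hA : IsGradedFamily A) (t : ℝ) :
    Convex ℝ (limitSlice A t) := by
  intro y hy z hz a b ha hb hab
  rw [limitSlice, Set.mem_preimage, sliceMap_combo t y z hab]
  exact hA.convex_limitShape hy hz ha hb hab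

/-- Adding `ε` to all coordinates leaves the hyperplane of the slice. Mixing with `e - η`, which is
still in the open limiting shape, returns to it: for `ε = s η / (1 - s)` the shifts cancel, so `(1 -
s) y + s e` lies in the slice, and `s → 0`. -/
theorem IsGradedFamily.mem_closure_of_frequently (hA : IsGradedFamily A) {e : Fin n → ℝ}
    (he : e ∈ limitSlice A t) {y : Fin n → ℝ} (hy : ∃ᶠ m in atTop, y ∈ sliceCells A t m) :
    y ∈ closure (limitSlice A t) := by
  obtain ⟨η, hη, hη0⟩ : ∃ η : ℝ, (fun i => sliceMap t e i - η) ∈ limitShape A ∧ 0 < η := by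
    have hc : Continuous fun η : ℝ => (fun i => sliceMap t e i - η) := by fun_prop
    have h0 : ∀ᶠ η : ℝ in 𝓝 0, (fun i => sliceMap t e i - η) ∈ limitShape A := by
      refine hc.continuousAt.eventually_mem ((isOpen_limitShape A).mem_nhds ?_)
      simp only [sub_zero]
      exact he
    exact ((h0.filter_mono nhdsWithin_le_nhds).and
      (self_mem_nhdsWithin : ∀ᶠ η : ℝ in 𝓝[>] 0, η ∈ Set.Ioi 0)).exists
  have hlim : Tendsto (fun s : ℝ => (1 - s) • y + s • e) (𝓝[>] 0) (𝓝 y) := by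
    have hc : Continuous fun s : ℝ => (1 - s) • y + s • e := by fun_prop
    have := hc.tendsto 0
    simp only [sub_zero, one_smul, zero_smul, add_zero] at this
    exact this.mono_left nhdsWithin_le_nhds
  refine mem_closure_of_tendsto hlim ?_
  filter_upwards [Ioo_mem_nhdsGT (zero_lt_one' ℝ)] with s hs
  have hs1 : 0 < 1 - s := sub_pos.2 hs.2
  rw [limitSlice, Set.mem_preimage, sliceMap_combo t y e (by ring)]
  have h := hA.convex_limitShape
    (add_mem_limitShape_of_frequently hy (div_pos (mul_pos hs.1 hη0) hs1)) hη hs1.le hs.1.le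
    (by ring)
  convert h using 1
  funext i
  simp only [Pi.add_apply, Pi.smul_apply, smul_eq_mul]
  field_simp
  ring

theorem limitSlice_nonempty {γ : Fin (n + 1) → ℕ} (hγ : γ ∈ A 1) (ht : ∑ i, γ i < t) :
    (limitSlice A t).Nonempty := by
  have hn : (0 : ℝ) < n + 1 := by positivity
  -- The `n` free coordinates are raised by `n / (n + 1) < 1` in total, so the first coordinate
  -- still exceeds `γ 0`.
  refine ⟨fun i => γ i.succ + 1 / (n + 1), 1, le_rfl, γ, hγ, fun i => ?_⟩
  refine Fin.cases ?_ (fun i => ?_) i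
  · have h : ((∑ i, γ i : ℕ) : ℝ) + 1 ≤ t := by exact_mod_cast ht
    rw [Fin.sum_univ_succ] at h
    push_cast at h
    have h2 : (n : ℝ) * (1 / (n + 1)) < 1 := by
      rw [mul_one_div, div_lt_one hn]
      linarith
    simp only [sliceMap, Fin.cons_zero, Finset.sum_add_distrib, Finset.sum_const,
      Finset.card_univ, Fintype.card_fin, nsmul_eq_mul, Nat.cast_one, one_mul]
    linarith
  · simp only [sliceMap, Fin.cons_succ, Nat.cast_one, one_mul]
    have : 0 < 1 / ((n : ℝ) + 1) := by positivity
    linarith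

/-- The number of exponents of degree `m * t` in the `m`-th member of a graded family of monomial
ideals grows like the volume of a slice of the limiting shape times `m ^ n`. -/
theorem IsGradedFamily.tendsto_degreeCount (hA : IsGradedFamily A) {γ : Fin (n + 1) → ℕ}
    (hγ : γ ∈ A 1) (ht : ∑ i, γ i < t) :
    Tendsto (fun m : ℕ => (degreeCount (A m) (m * t) : ℝ) / (m : ℝ) ^ n) atTop
      (𝓝 (MeasureTheory.volume (limitSlice A t)).toReal) := by
  obtain ⟨e, he⟩ := limitSlice_nonempty hγ ht
  have hfin : MeasureTheory.volume (Set.Icc (0 : Fin n → ℝ) (fun _ => (t : ℝ) + 1)) ≠ ⊤ :=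
    isCompact_Icc.measure_lt_top.ne
  have hlim : Tendsto (fun m => MeasureTheory.volume (sliceCells A t m)) atTop
      (𝓝 (MeasureTheory.volume (limitSlice A t))) := by
    -- Indicators converge off the frontier of the slice, which is null by convexity; a common
    -- bounded box supplies the domination.
    refine MeasureTheory.tendsto_measure_of_ae_tendsto_indicator atTop
      (isOpen_limitSlice A t).measurableSet (fun m => measurableSet_sliceCells)
      measurableSet_Icc hfin ?_ ?_
    · filter_upwards [eventually_gt_atTop 0] with m hm
      exact sliceCells_subset hm
    · have hfr := (hA.convex_limitSlice t).addHaar_frontier MeasureTheory.volume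
      filter_upwards [MeasureTheory.measure_eq_zero_iff_ae_notMem.1 hfr] with y hy
      by_cases hyE : y ∈ limitSlice A t
      · filter_upwards [hA.eventually_mem_sliceCells hγ hyE] with m hm
        exact iff_of_true hm hyE
      · have hcl : y ∉ closure (limitSlice A t) := fun h => hy
          ⟨h, by rwa [(isOpen_limitSlice A t).interior_eq]⟩
        have := not_frequently.1 (mt (hA.mem_closure_of_frequently he) hcl)
        filter_upwards [this] with m hm
        exact iff_of_false hm hyE
  refine ((ENNReal.tendsto_toReal ((MeasureTheory.measure_mono limitSlice_subset).trans_lt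
    hfin.lt_top).ne).comp hlim).congr' ?_
  filter_upwards [eventually_gt_atTop 0] with m hm
  exact volume_sliceCells hm

end

/-! ### Asymptotic Hilbert function of the symbolic powers -/

theorem isGradedFamily_leadExponents (I : Ideal (CoordRing K n)) :
    IsGradedFamily fun m => leadExponents (symbolicPower I m) where
  isUpperSet _ := isUpperSet_leadExponents _
  add_mem hα hβ := add_mem_leadExponents (symbolicPower_mul_le I _ _) hα hβ

theorem isGradedFamily_univ {d : ℕ} :
    IsGradedFamily fun _ => (Set.univ : Set (Fin d → ℕ)) where
  isUpperSet _ := isUpperSet_univ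
  add_mem _ _ := trivial

theorem leadExponents_bot : leadExponents (⊥ : Ideal (CoordRing K n)) = ∅ := by
  refine Set.eq_empty_of_forall_notMem ?_
  rintro α ⟨f, hf, h0, -⟩
  exact h0 hf

/-- For large `t`, the dimensions of the graded pieces of degree `m * t` of the symbolic powers
`I⁽ᵐ⁾` grow like a multiple of `m ^ n`. -/
theorem exists_forall_tendsto_degreeCount {I : Ideal (CoordRing K n)}
    (hI : IsHomogeneousIdeal I) : ∃ T : ℕ, ∀ t : ℕ, T < t → ∃ v : ℝ,
      Tendsto (fun m : ℕ => (degreeCount (leadExponents (symbolicPower I m)) (m * t) : ℝ) /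
        (m : ℝ) ^ n) atTop (𝓝 v) := by
  by_cases h0 : I = ⊥
  · refine ⟨0, fun t _ => ⟨0, tendsto_const_nhds.congr' ?_⟩⟩
    filter_upwards [eventually_gt_atTop 0] with m hm
    simp [h0, symbolicPower_bot hm.ne', leadExponents_bot, degreeCount]
  · obtain ⟨γ, f, hf, hγ⟩ := leadExponents_nonempty hI h0
    have hmem : γ ∈ leadExponents (symbolicPower I 1) :=
      ⟨f, pow_le_symbolicPower I 1 (by rwa [pow_one]), hγ⟩
    -- The threshold is the degree of a nonzero form in `I`.
    exact ⟨∑ i, γ i, fun t ht =>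
      ⟨_, (isGradedFamily_leadExponents I).tendsto_degreeCount hmem ht⟩⟩

/-- The asymptotic Hilbert function: `HF_{I⁽ᵐ⁾}(m t) / m ^ n` converges for large integers `t`. -/
theorem exists_forall_tendsto_hilbertFunction {I : Ideal (CoordRing K n)}
    (hI : IsHomogeneousIdeal I) : ∃ T : ℕ, ∀ t : ℕ, T < t → ∃ v : ℝ,
      Tendsto (fun m : ℕ => (hilbertFunction (symbolicPower I m) (m * t) : ℝ) / (m : ℝ) ^ n)
        atTop (𝓝 v) := by
  obtain ⟨T, hT⟩ := exists_forall_tendsto_degreeCount hI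
  refine ⟨T, fun t ht => ?_⟩
  obtain ⟨v, hv⟩ := hT t ht
  -- The growth of `dim R_{mt}` is the same counting theorem for the constant family of all
  -- exponents.
  have huniv := isGradedFamily_univ.tendsto_degreeCount (n := n) (γ := 0) (t := t) trivial
    (by simpa using (Nat.zero_le T).trans_lt ht)
  refine ⟨_, (huniv.sub hv).congr fun m => ?_⟩
  rw [← hilbertFunction_add_degreeCount (symbolicPower I m), ← sub_div]
  push_cast
  rw [add_sub_cancel_right]

/-! ### Passage to Hilbert polynomials and interpolation -/

theorem natDegree_scaledHilbertPolynomial_le (I : Ideal (CoordRing K n)) (m : ℕ) :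
    (scaledHilbertPolynomial I m).natDegree ≤ n := by
  refine (natDegree_C_mul_le _ _).trans (natDegree_comp_le.trans ?_)
  calc _ ≤ n * 1 := Nat.mul_le_mul
        (natDegree_map_le.trans (natDegree_hilbertPolynomial_le _)) ((natDegree_C_mul_le _ _).trans natDegree_X_le)
    _ = n := mul_one n

theorem eval_scaledHilbertPolynomial (I : Ideal (CoordRing K n)) (m : ℕ) (t : ℝ) :
    (scaledHilbertPolynomial I m).eval t =
      ((hilbertPolynomial (symbolicPower I m)).map (algebraMap ℚ ℝ)).eval ((m : ℝ) * t) /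
        (m : ℝ) ^ n := by
  simp only [scaledHilbertPolynomial, eval_mul, eval_comp, eval_C, eval_X]
  rw [div_eq_inv_mul]

/-- Both the regularity bound and the degree `m * t` grow linearly in `m`, so a single threshold on
`t` serves all large `m`: for `m ≥ 1`, `a m + b + n + 1 ≤ m (a + b + n + 1) < m t`. -/
theorem exists_forall_tendsto_scaledHilbertPolynomial {I : Ideal (CoordRing K n)}
    (hI : IsHomogeneousIdeal I) (hreg : IsLBSR I) : ∃ T : ℕ, ∀ t : ℕ, T < t → ∃ v : ℝ,
      Tendsto (fun m : ℕ => (scaledHilbertPolynomial I m).eval (t : ℝ)) atTop (𝓝 v) := by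
  obtain ⟨T, hT⟩ := exists_forall_tendsto_hilbertFunction hI
  obtain ⟨a, b, ha, hb, hab⟩ := hreg
  obtain ⟨T', hT'⟩ := exists_nat_ge (a + b + n + 1)
  refine ⟨max T T', fun t ht => ?_⟩
  obtain ⟨v, hv⟩ := hT t ((le_max_left _ _).trans_lt ht)
  refine ⟨v, hv.congr' ?_⟩
  have ht' : a + b + n + 1 < t :=
    hT'.trans_lt (by exact_mod_cast (le_max_right T T').trans_lt ht)
  have ht0 : 0 < t := (Nat.zero_le _).trans_lt ht
  filter_upwards [hab, eventually_ge_atTop 1] with m hm hm1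
  have hm1' : (1 : ℝ) ≤ m := by exact_mod_cast hm1
  have hlt : a * m + b + n + 1 < ((m * t : ℕ) : ℝ) := by
    push_cast
    have hn : (0 : ℝ) ≤ n := Nat.cast_nonneg n
    nlinarith
  have h := eval_hilbertPolynomial_of_regularity_le hm (Nat.mul_pos hm1 ht0) hlt
  rw [eval_scaledHilbertPolynomial]
  congr 1
  have h2 : (m : ℝ) * t = algebraMap ℚ ℝ ((m * t : ℕ) : ℚ) := by simp
  rw [h2, eval_map_algebraMap, aeval_algebraMap_apply_eq_algebraMap_eval, h]
  simp

/-- If polynomials of degree at most `n` converge at `n + 1` points, they converge everywhere, and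
the limit is a polynomial of degree at most `n`. -/
theorem exists_polynomial_tendsto_eval {q : ℕ → ℝ[X]} (hdeg : ∀ m, (q m).natDegree ≤ n)
    {x : Fin (n + 1) → ℝ} (hx : Function.Injective x)
    (hq : ∀ i, ∃ v, Tendsto (fun m => (q m).eval (x i)) atTop (𝓝 v)) :
    ∃ P : ℝ[X], P.natDegree ≤ n ∧ ∀ t, Tendsto (fun m => (q m).eval t) atTop (𝓝 (P.eval t)) := by
  choose v hv using hq
  have hinj : Set.InjOn x (Finset.univ : Finset (Fin (n + 1))) := hx.injOn
  refine ⟨Lagrange.interpolate Finset.univ x v, ?_, fun t => ?_⟩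
  · refine natDegree_le_of_degree_le ?_
    simpa using Lagrange.degree_interpolate_le v hinj
  -- Each value of `q m` is a combination of its values at the nodes with weights independent of
  -- `m`, so the limit passes through the finite sum.
  · have h : ∀ m, q m = Lagrange.interpolate Finset.univ x fun i => (q m).eval (x i) := fun m =>
      Lagrange.eq_interpolate hinj (by
        rw [Finset.card_univ, Fintype.card_fin]
        exact degree_le_natDegree.trans_lt (by exact_mod_cast Nat.lt_succ_of_le (hdeg m)))
    have h' : ∀ m, (q m).eval t = ∑ i, (q m).eval (x i) * (Lagrange.basis Finset.univ x i).eval t :=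
      fun m => by
        conv_lhs => rw [h m]
        simp [Lagrange.interpolate_apply, eval_finsetSum]
    simp only [h', Lagrange.interpolate_apply, eval_finsetSum, eval_mul, eval_C]
    exact tendsto_finsetSum _ fun i _ => (hv i).mul_const _

end AsympHilbert

end

theorem mainTheorem4 {K : Type*} [Field K] [IsAlgClosed K] [CharZero K] (n : ℕ)
    (I : Ideal (AsympHilbert.CoordRing K n))
    (hhom : AsympHilbert.IsHomogeneousIdeal I) (hrad : I.IsRadical) (hreg : AsympHilbert.IsLBSR I) :
    (∀ m : ℕ, 1 ≤ m → (AsympHilbert.scaledHilbertPolynomial I m).natDegree ≤ n) ∧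
    (∀ t : ℝ, Tendsto (fun m : ℕ => (AsympHilbert.scaledHilbertPolynomial I m).eval t) atTop
      (𝓝 (AsympHilbert.aHP I t))) ∧
    ∃ P : ℝ[X], P.natDegree ≤ n ∧ ∀ t : ℝ, AsympHilbert.aHP I t = P.eval t := by
  obtain ⟨T, hT⟩ := AsympHilbert.exists_forall_tendsto_scaledHilbertPolynomial hhom hreg
  obtain ⟨P, hP, hlim⟩ := AsympHilbert.exists_polynomial_tendsto_eval
    (AsympHilbert.natDegree_scaledHilbertPolynomial_le I)
    -- The nodes are the `n + 1` integers following the threshold `T`.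
    (x := fun i : Fin (n + 1) => ((T + 1 + i : ℕ) : ℝ))
    (fun i j h => Fin.ext (by simpa using h)) (fun i => hT _ (by omega))
  have haHP : ∀ t : ℝ, AsympHilbert.aHP I t = P.eval t := fun t =>
    Tendsto.limUnder_eq
      ((hlim t).congr fun m => AsympHilbert.eval_scaledHilbertPolynomial I m t)
  refine ⟨fun m _ => AsympHilbert.natDegree_scaledHilbertPolynomial_le I m, fun t => ?_,
    P, hP, haHP⟩
  rw [haHP t]
  exact hlim t
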